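/- Let $(X,\Sigma,\mu)$ be a finite measure space and $H=L^2(X)$ (complex-valued functions), with scalar product $(\cdot|\cdot)_H$ linear in the first argument. Let $(a,j)$ be a sectorial form in $H$: $D(a)$ is a complex vector space, $a\colon D(a)\times D(a)\to\mathbb{C}$ is sesquilinear, $j\colon D(a)\to H$ is linear with dense image, and there are $\omega\in\mathbb{R}$ and $\theta\in[0,\frac{\pi}{2})$ such that $a(u,u)+\omega\|j(u)\|_H^2\in\{re^{i\alpha}: r\ge 0,\ |\alpha|\le\theta\}$ for all $u\in D(a)$. Let $A$ be the operator in $H$ associated with $(a,j)$: for $x,y\in H$ one has $x\in D(A)$ and $Ax=y$ if and only if there is a sequence $(u_n)$ in $D(a)$ such that $j(u_n)\to x$ in $H$, $a(u_n-u_m,u_n-u_m)\to 0$ as $n,m\to\infty$, and $a(u_n,v)\to (y|j(v))_H$ for all $v\in D(a)$. Let $A_\infty$ be the part of $A$ in $L^\infty(X)$, that is, $D(A_\infty)=\{u\in D(A)\cap L^\infty(X): Au\in L^\infty(X)\}$ and $A_\infty u=Au$. Let $Q$ be the orthogonal projection of $H$ onto $C_\infty=\{f\in H: |f|\le 1 \text{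 a.e.}\}$, that is, $Qf=(|f|\wedge 1)\operatorname{sign} f$, where $\operatorname{sign} f=f/|f|$ where $f\neq 0$ and $\operatorname{sign} f=0$ where $f=0$. Assume that for every $u\in D(a)$ there exists $w\in D(a)$ such that $Qj(u)=j(w)$ and $\operatorname{Re} a(w,u-w)\ge 0$. Then $-A_\infty$ is m-dissipative in $L^\infty(X)$, i.e. $(0,\infty)\subset\rho(-A_\infty)$ and $\|\lambda R(\lambda,-A_\infty)\|_{\mathcal{L}(L^\infty(X))}\le 1$ for all $\lambda>0$, where $R(\lambda,-A_\infty)=(\lambda+A_\infty)^{-1}$. -/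

import Mathlib

open Filter Topology MeasureTheory
open scoped ENNReal

noncomputable section

namespace FormMethod

/-- The closed sector `{r e^{iα} : r ≥ 0, |α| ≤ θ}` in the complex plane. -/
def sector (θ : ℝ) : Set ℂ :=
  {z | ∃ r α : ℝ, 0 ≤ r ∧ |α| ≤ θ ∧ z = (r : ℂ) * Complex.exp ((α : ℂ) * Complex.I)}

/-- A sectorial form `(a, j)` in the complex inner product space `H`
(a Hilbert space in the application, where `H = L²(X)`) with form domain `V = D(a)`:
`V` is just a complex vector space (no topology), `a` is sesquilinear (linear in the first and
antilinear in the second argument), `j : V → H` is linear with dense image, and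
`a(u,u) + ω ‖j u‖²` stays in a sector of half angle `θ < π/2`. -/
structure SectorialForm (V H : Type*) [AddCommGroup V] [Module ℂ V]
    [NormedAddCommGroup H] [InnerProductSpace ℂ H] where
  /-- the sesquilinear form -/
  a : V →ₗ[ℂ] V →ₗ⋆[ℂ] ℂ
  /-- the (not necessarily injective) map into the Hilbert space -/
  j : V →ₗ[ℂ] H
  denseRange_j : DenseRange j
  sectorial : ∃ ω θ : ℝ, 0 ≤ θ ∧ θ < Real.pi / 2 ∧
    ∀ u : V, a u u + ((ω * ‖j u‖ ^ 2 : ℝ) : ℂ) ∈ sector θ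

section Operator

variable {V H : Type*} [AddCommGroup V] [Module ℂ V]
  [NormedAddCommGroup H] [InnerProductSpace ℂ H]

/-- `𝔞.Rel x y` is the relation `x ∈ D(A)` and `A x = y` for the operator `A` associated with
the form `𝔞 = (a, j)`. Mathlib's inner product is antilinear in its *first* argument, so
`inner ℂ (j v) y` is the scalar product `(y | j v)`. -/
def SectorialForm.Rel (𝔞 : SectorialForm V H) (x y : H) : Prop :=
  ∃ u : ℕ → V,
    Tendsto (fun n => 𝔞.j (u n)) atTop (𝓝 x) ∧
    Tendsto (fun p : ℕ × ℕ => 𝔞.a (u p.1 - u p.2) (u p.1 - u p.2)) atTop (𝓝 0) ∧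
    ∀ v : V, Tendsto (fun n => 𝔞.a (u n) v) atTop (𝓝 (inner ℂ (𝔞.j v) y))

/-- The real part of a sectorial form, shifted by `ω`, is nonnegative and dominates the form. -/
theorem SectorialForm.exists_bound (𝔞 : SectorialForm V H) :
    ∃ ω K : ℝ, 0 ≤ K ∧ ∀ u : V, 0 ≤ (𝔞.a u u).re + ω * ‖𝔞.j u‖ ^ 2 ∧
      ‖𝔞.a u u + ((ω * ‖𝔞.j u‖ ^ 2 : ℝ) : ℂ)‖ ≤ K * ((𝔞.a u u).re + ω * ‖𝔞.j u‖ ^ 2) := by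
  obtain ⟨ω, θ, h0, hθ, h⟩ := 𝔞.sectorial
  have hc : 0 < Real.cos θ := Real.cos_pos_of_mem_Ioo ⟨by linarith, hθ⟩
  refine ⟨ω, (Real.cos θ)⁻¹, by positivity, fun u => ?_⟩
  obtain ⟨r, α, hr, hα, hz⟩ := h u
  have hcos : Real.cos θ ≤ Real.cos α := by
    rw [← Real.cos_abs α]
    exact Real.cos_le_cos_of_nonneg_of_le_pi (abs_nonneg α) (by linarith [Real.pi_pos]) hα
  have hre : (𝔞.a u u).re + ω * ‖𝔞.j u‖ ^ 2 = r * Real.cos α := by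
    have := congrArg Complex.re hz
    rwa [Complex.add_re, Complex.ofReal_re, Complex.re_ofReal_mul,
      Complex.exp_ofReal_mul_I_re] at this
  have hn : ‖𝔞.a u u + ((ω * ‖𝔞.j u‖ ^ 2 : ℝ) : ℂ)‖ = r := by
    rw [hz, norm_mul, Complex.norm_exp_ofReal_mul_I, mul_one, Complex.norm_real,
      Real.norm_of_nonneg hr]
  rw [hre, hn]
  refine ⟨mul_nonneg hr (hc.le.trans hcos), ?_⟩
  rw [inv_mul_eq_div, le_div_iff₀ hc]
  exact mul_le_mul_of_nonneg_left hcos hr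

/-- The part of the definition of `A` that is the Cauchy condition, in terms of real parts. -/
theorem SectorialForm.tendsto_iff (𝔞 : SectorialForm V H) {ω K : ℝ}
    (hK : ∀ u : V, 0 ≤ (𝔞.a u u).re + ω * ‖𝔞.j u‖ ^ 2 ∧
      ‖𝔞.a u u + ((ω * ‖𝔞.j u‖ ^ 2 : ℝ) : ℂ)‖ ≤ K * ((𝔞.a u u).re + ω * ‖𝔞.j u‖ ^ 2))
    {u : ℕ → V} {x : H} (hx : Tendsto (fun n => 𝔞.j (u n)) atTop (𝓝 x)) :
    Tendsto (fun p : ℕ × ℕ => 𝔞.a (u p.1 - u p.2) (u p.1 - u p.2)) atTop (𝓝 0) ↔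
    Tendsto (fun p : ℕ × ℕ => (𝔞.a (u p.1 - u p.2) (u p.1 - u p.2)).re
      + ω * ‖𝔞.j (u p.1 - u p.2)‖ ^ 2) atTop (𝓝 0) := by
  have hj : Tendsto (fun p : ℕ × ℕ => ω * ‖𝔞.j (u p.1 - u p.2)‖ ^ 2) atTop (𝓝 0) := by
    rw [← prod_atTop_atTop_eq]
    have := (hx.comp tendsto_fst).sub (hx.comp (tendsto_snd (f := atTop (α := ℕ))))
    have := ((this.norm.pow 2).const_mul ω)
    simpa [Function.comp_def] using this
  constructor
  · intro h
    simpa using ((Complex.continuous_re.tendsto 0).comp h).add hj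
  · intro h
    have h1 : Tendsto (fun p : ℕ × ℕ => 𝔞.a (u p.1 - u p.2) (u p.1 - u p.2)
        + ((ω * ‖𝔞.j (u p.1 - u p.2)‖ ^ 2 : ℝ) : ℂ)) atTop (𝓝 0) :=
      squeeze_zero_norm (fun p => (hK _).2) (by simpa using h.const_mul K)
    have h2 := h1.sub ((Complex.continuous_ofReal.tendsto 0).comp hj)
    simpa [Function.comp_def] using h2

theorem SectorialForm.Rel.add {𝔞 : SectorialForm V H} {x x' y y' : H}
    (h : 𝔞.Rel x y) (h' : 𝔞.Rel x' y') : 𝔞.Rel (x + x') (y + y') := by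
  obtain ⟨ω, K, -, hK⟩ := 𝔞.exists_bound
  obtain ⟨u, h1, h2, h3⟩ := h
  obtain ⟨w, k1, k2, k3⟩ := h'
  have h4 : Tendsto (fun n => 𝔞.j (u n + w n)) atTop (𝓝 (x + x')) := by
    simpa using h1.add k1
  refine ⟨fun n => u n + w n, h4, (𝔞.tendsto_iff hK h4).2 ?_, fun v => ?_⟩
  · rw [𝔞.tendsto_iff hK h1] at h2
    rw [𝔞.tendsto_iff hK k1] at k2
    have h5 := (h2.add k2).const_mul 2
    rw [add_zero, mul_zero] at h5
    refine squeeze_zero (fun p => (hK _).1) (fun p => ?_) h5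
    have e : u p.1 + w p.1 - (u p.2 + w p.2) = (u p.1 - u p.2) + (w p.1 - w p.2) := by abel
    rw [e]
    generalize u p.1 - u p.2 = s
    generalize w p.1 - w p.2 = t
    have hp := (hK (s - t)).1
    have hq : ‖𝔞.j (s + t)‖ ^ 2 + ‖𝔞.j (s - t)‖ ^ 2 = 2 * (‖𝔞.j s‖ ^ 2 + ‖𝔞.j t‖ ^ 2) := by
      have := parallelogram_law_with_norm ℂ (𝔞.j s) (𝔞.j t)
      rw [map_add, map_sub]
      linarith
    have hr : (𝔞.a (s + t) (s + t)).re + (𝔞.a (s - t) (s - t)).re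
        = 2 * ((𝔞.a s s).re + (𝔞.a t t).re) := by
      simp only [map_add, map_sub, LinearMap.add_apply, LinearMap.sub_apply, Complex.add_re,
        Complex.sub_re]
      ring
    have hq' := congrArg (fun z => ω * z) hq
    linarith
  · simpa [inner_add_right] using (h3 v).add (k3 v)

theorem SectorialForm.Rel.smul {𝔞 : SectorialForm V H} {x y : H} (c : ℂ)
    (h : 𝔞.Rel x y) : 𝔞.Rel (c • x) (c • y) := by
  obtain ⟨u, h1, h2, h3⟩ := h
  refine ⟨fun n => c • u n, by simpa using h1.const_smul c, ?_, fun v => ?_⟩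
  · simpa only [← smul_sub, map_smul, LinearMap.smul_apply, LinearMap.map_smulₛₗ, smul_eq_mul,
      mul_zero] using (h2.const_mul c).const_mul (starRingEnd ℂ c)
  · simpa [inner_smul_right] using (h3 v).const_mul c

/-- The graph of the operator associated with a sectorial form. -/
def SectorialForm.operatorGraph (𝔞 : SectorialForm V H) : Submodule ℂ (H × H) where
  carrier := {p | 𝔞.Rel p.1 p.2}
  add_mem' h h' := h.add h'
  zero_mem' := ⟨fun _ => 0, by simp, by simp, by simp⟩
  smul_mem' c _ h := h.smul c

/-- A weighted Cauchy-Schwarz inequality for sectorial sesquilinear maps. -/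
theorem weighted_bound (b : V →ₗ[ℂ] V →ₗ⋆[ℂ] ℂ) {K : ℝ}
    (h : ∀ u, 0 ≤ (b u u).re ∧ ‖b u u‖ ≤ K * (b u u).re) (u v : V) {s : ℝ} (hs : 0 ≤ s) :
    s * ‖b u v‖ ≤ K * (s ^ 2 * (b u u).re + (b v v).re) := by
  have key : ∀ u v : V, ‖b u v‖ ≤ K * ((b u u).re + (b v v).re) := by
    intro u v
    have e : 4 * b u v = b (u + v) (u + v) - b (u - v) (u - v)
        + Complex.I * b (u + Complex.I • v) (u + Complex.I • v)
        - Complex.I * b (u - Complex.I • v) (u - Complex.I • v) := by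
      simp only [map_add, map_sub, LinearMap.add_apply, LinearMap.sub_apply, map_smul,
        LinearMap.smul_apply, LinearMap.map_smulₛₗ, smul_eq_mul, Complex.conj_I]
      linear_combination (2 * b u v - 2 * b v u) * Complex.I_mul_I
    have e2 : (b (u + v) (u + v)).re + (b (u - v) (u - v)).re
        + (b (u + Complex.I • v) (u + Complex.I • v)).re
        + (b (u - Complex.I • v) (u - Complex.I • v)).re
        = 4 * ((b u u).re + (b v v).re) := by
      simp only [map_add, map_sub, LinearMap.add_apply, LinearMap.sub_apply, map_smul,
        LinearMap.smul_apply, LinearMap.map_smulₛₗ, smul_eq_mul, Complex.conj_I,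
        Complex.add_re, Complex.sub_re, Complex.mul_re, Complex.mul_im, Complex.I_re,
        Complex.I_im, Complex.neg_re, Complex.neg_im,
        Complex.add_im, Complex.sub_im]
      ring
    have n4 : 4 * ‖b u v‖ = ‖4 * b u v‖ := by simp
    have hI : ∀ z : ℂ, ‖Complex.I * z‖ = ‖z‖ := fun z => by simp
    have tri : ‖4 * b u v‖ ≤ ‖b (u + v) (u + v)‖ + ‖b (u - v) (u - v)‖
        + ‖b (u + Complex.I • v) (u + Complex.I • v)‖
        + ‖b (u - Complex.I • v) (u - Complex.I • v)‖ := by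
      rw [e]
      refine (norm_sub_le _ _).trans ?_
      rw [hI]
      gcongr
      refine (norm_add_le _ _).trans ?_
      rw [hI]
      gcongr
      exact norm_sub_le _ _
    have e3 := congrArg (fun z => K * z) e2
    simp only [mul_add] at e3
    linarith [(h (u + v)).2, (h (u - v)).2, (h (u + Complex.I • v)).2,
      (h (u - Complex.I • v)).2]
  have := key ((s : ℂ) • u) v
  simp only [map_smul, LinearMap.smul_apply, LinearMap.map_smulₛₗ, smul_eq_mul, norm_mul,
    Complex.conj_ofReal, Complex.norm_real, Real.norm_of_nonneg hs,
    Complex.re_ofReal_mul] at this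
  linarith

/-- The operator associated with a sectorial form is well-defined. -/
theorem SectorialForm.Rel.eq_zero {𝔞 : SectorialForm V H} {y : H} (h : 𝔞.Rel 0 y) : y = 0 := by
  obtain ⟨ω, K, hK0, hK⟩ := 𝔞.exists_bound
  obtain ⟨u, h1, h2, h3⟩ := h
  rw [𝔞.tendsto_iff hK h1] at h2
  let b : V →ₗ[ℂ] V →ₗ⋆[ℂ] ℂ := LinearMap.mk₂'ₛₗ (RingHom.id ℂ) (starRingEnd ℂ)
    (fun u v => 𝔞.a u v + (ω : ℂ) * inner ℂ (𝔞.j v) (𝔞.j u))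
    (fun _ _ _ => by simp only [map_add, LinearMap.add_apply, inner_add_right]; ring)
    (fun _ _ _ => by
      simp only [map_smul, LinearMap.smul_apply, inner_smul_right, smul_eq_mul, RingHom.id_apply]
      ring)
    (fun _ _ _ => by simp only [map_add, inner_add_left]; ring)
    (fun _ _ _ => by
      simp only [map_smul, LinearMap.map_smulₛₗ, inner_smul_left, smul_eq_mul]
      ring)
  have hb : ∀ u v, b u v = 𝔞.a u v + (ω : ℂ) * inner ℂ (𝔞.j v) (𝔞.j u) := fun _ _ => rfl
  have hbb : ∀ u, b u u = 𝔞.a u u + ((ω * ‖𝔞.j u‖ ^ 2 : ℝ) : ℂ) := fun u => by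
    rw [hb, inner_self_eq_norm_sq_to_K]
    simp
  have hre : ∀ u, (b u u).re = (𝔞.a u u).re + ω * ‖𝔞.j u‖ ^ 2 := fun u => by
    rw [hbb, Complex.add_re, Complex.ofReal_re]
  have hq : ∀ u, 0 ≤ (b u u).re ∧ ‖b u u‖ ≤ (K + 1) * (b u u).re := fun u => by
    have := hK u
    rw [← hbb, ← hre] at this
    exact ⟨this.1, by linarith [this.1, this.2]⟩
  have hlim : ∀ v, Tendsto (fun n => b (u n) v) atTop (𝓝 (inner ℂ (𝔞.j v) y)) := fun v => by
    have : Tendsto (fun n => (inner ℂ (𝔞.j v) (𝔞.j (u n)) : ℂ)) atTop (𝓝 0) := by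
      simpa using (tendsto_const_nhds (x := 𝔞.j v)).inner h1
    simpa [hb] using (h3 v).add (this.const_mul (ω : ℂ))
  simp only [← hre] at h2
  have hC : ∀ x z : V,
      (b x x).re ≤ 4 * (K + 1) ^ 2 * (b (x - z) (x - z)).re + 2 * ‖b x z‖ := by
    intro x z
    have hs : (0 : ℝ) < 1 / (2 * (K + 1)) := by positivity
    have w := weighted_bound b hq x (x - z) hs.le
    have w2 : ‖b x (x - z)‖ ≤ (b x x).re / 2 + 2 * (K + 1) ^ 2 * (b (x - z) (x - z)).re := by
      have := mul_le_mul_of_nonneg_left w (show (0 : ℝ) ≤ 2 * (K + 1) by positivity)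
      have e3 : 2 * (K + 1) * (1 / (2 * (K + 1)) * ‖b x (x - z)‖) = ‖b x (x - z)‖ := by
        field_simp
      have e4 : 2 * (K + 1) * ((K + 1) * ((1 / (2 * (K + 1))) ^ 2 * (b x x).re
          + (b (x - z) (x - z)).re))
          = (b x x).re / 2 + 2 * (K + 1) ^ 2 * (b (x - z) (x - z)).re := by
        field_simp
      rwa [e3, e4] at this
    have e : b x x = b x (x - z) + b x z := by rw [map_sub]; ring
    have e' : (b x x).re = (b x (x - z)).re + (b x z).re := by
      rw [← Complex.add_re, ← e]
    linarith [Complex.re_le_norm (b x (x - z)), Complex.re_le_norm (b x z)]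
  have hy : Tendsto (fun m => ‖(inner ℂ (𝔞.j (u m)) y : ℂ)‖) atTop (𝓝 0) := by
    simpa using (h1.inner (𝕜 := ℂ) (tendsto_const_nhds (x := y))).norm
  have hzero : Tendsto (fun n => (b (u n) (u n)).re) atTop (𝓝 0) := by
    rw [Metric.tendsto_atTop]
    intro ε hε
    set δ : ℝ := ε / (4 * (K + 1) ^ 2 + 3) with hδ
    have hδ0 : 0 < δ := by positivity
    obtain ⟨⟨N, M⟩, hN⟩ := eventually_atTop.1 (h2.eventually (gt_mem_nhds hδ0))
    obtain ⟨m, hm, hmM⟩ :=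
      ((hy.eventually (gt_mem_nhds hδ0)).and (eventually_ge_atTop M)).exists
    have hn := (hlim (u m)).norm.eventually (gt_mem_nhds hm)
    obtain ⟨N', hN'⟩ := eventually_atTop.1 hn
    refine ⟨max N N', fun n hn => ?_⟩
    have a1 := hN (n, m) ⟨(le_max_left _ _).trans hn, hmM⟩
    have a2 := hN' n ((le_max_right _ _).trans hn)
    have a3 := hC (u n) (u m)
    rw [Real.dist_eq, sub_zero, abs_of_nonneg (hq _).1]
    have a4 : 4 * (K + 1) ^ 2 * (b (u n - u m) (u n - u m)).re ≤ 4 * (K + 1) ^ 2 * δ :=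
      mul_le_mul_of_nonneg_left a1.le (by positivity)
    have a5 : (4 * (K + 1) ^ 2 + 3) * δ = ε := by rw [hδ]; field_simp
    linarith
  have hin : ∀ v, (inner ℂ (𝔞.j v) y : ℂ) = 0 := by
    intro v
    by_contra hne
    have hpos : 0 < ‖(inner ℂ (𝔞.j v) y : ℂ)‖ := norm_pos_iff.2 hne
    have hle : ∀ s : ℝ, 0 ≤ s → s * ‖(inner ℂ (𝔞.j v) y : ℂ)‖ ≤ (K + 1) * (b v v).re := by
      intro s hs
      refine le_of_tendsto_of_tendsto' ((hlim v).norm.const_mul s)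
        (g := fun n => (K + 1) * (s ^ 2 * (b (u n) (u n)).re + (b v v).re)) ?_
        (fun n => weighted_bound b hq (u n) v hs)
      simpa using ((hzero.const_mul (s ^ 2)).add_const (b v v).re).const_mul (K + 1)
    have h0 : 0 ≤ (K + 1) * (b v v).re := mul_nonneg (by positivity) (hq v).1
    have := hle (((K + 1) * (b v v).re + 1) / ‖(inner ℂ (𝔞.j v) y : ℂ)‖) (by positivity)
    rw [div_mul_cancel₀ _ hpos.ne'] at this
    linarith
  refine 𝔞.denseRange_j.eq_zero_of_inner_right ℂ ?_
  exact hin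

/-- The operator `A` associated with a sectorial form. -/
def SectorialForm.operator (𝔞 : SectorialForm V H) : H →ₗ.[ℂ] H :=
  𝔞.operatorGraph.toLinearPMap

theorem SectorialForm.mem_graph_operator (𝔞 : SectorialForm V H) {x y : H} :
    (x, y) ∈ 𝔞.operator.graph ↔ 𝔞.Rel x y := by
  unfold SectorialForm.operator
  rw [Submodule.toLinearPMap_graph_eq]
  · rfl
  · rintro ⟨x, y⟩ hp (rfl : x = 0)
    exact SectorialForm.Rel.eq_zero hp

end Operator

section Part

variable {Z H : Type*} [AddCommGroup Z] [Module ℂ Z] [AddCommGroup H] [Module ℂ H]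

/-- The part of the operator `A` in a space `Z` embedded into `H` by `ι`:
its domain is `{u ∈ Z : ι u ∈ D(A), A (ι u) ∈ ι(Z)}`, and it acts as `A`. -/
def part (A : H →ₗ.[ℂ] H) (ι : Z →ₗ[ℂ] H) : Z →ₗ.[ℂ] Z :=
  (A.graph.comap (ι.prodMap ι)).toLinearPMap

theorem mem_graph_part (A : H →ₗ.[ℂ] H) (ι : Z →ₗ[ℂ] H) (hι : Function.Injective ι) {u v : Z} :
    (u, v) ∈ (part A ι).graph ↔ ∃ h : ι u ∈ A.domain, A ⟨ι u, h⟩ = ι v := by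
  unfold part
  rw [Submodule.toLinearPMap_graph_eq]
  · simp
  · rintro ⟨x, y⟩ hp (rfl : x = 0)
    have h : ((0 : H), ι y) ∈ A.graph := by simpa using hp
    exact hι (by rw [A.graph_fst_eq_zero_snd h rfl, map_zero])

end Part

section Dissipative

variable {Z : Type*} [NormedAddCommGroup Z] [NormedSpace ℂ Z]

/-- `R` is the resolvent `R(z, B) = (z - B)⁻¹`: a bounded operator on `Z` that is a two-sided
inverse of `z - B : D(B) → Z`. The point `z` belongs to the resolvent set `ρ(B)` if and only if
such an `R` exists, and `R` is then unique. -/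
def IsResolvent (B : Z →ₗ.[ℂ] Z) (z : ℂ) (R : Z →L[ℂ] Z) : Prop :=
  (∀ f : Z, ∃ h : R f ∈ B.domain, z • R f - B ⟨R f, h⟩ = f) ∧
  ∀ u : B.domain, R (z • (u : Z) - B u) = u

/-- `B` is m-dissipative: `(0,∞) ⊆ ρ(B)` and `‖l R(l, B)‖ ≤ 1` for all `l > 0`. -/
def IsMDissipative (B : Z →ₗ.[ℂ] Z) : Prop :=
  ∀ l : ℝ, 0 < l → ∃ R : Z →L[ℂ] Z, IsResolvent B (l : ℂ) R ∧ ‖(l : ℂ) • R‖ ≤ 1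

end Dissipative

section Lebesgue

variable {X : Type*} [MeasurableSpace X] (μ : Measure X)

/-- `z ↦ (|z| ∧ 1) sign z` with `sign z = z / |z|` for `z ≠ 0` and `sign 0 = 0`. -/
def truncate (z : ℂ) : ℂ := ((min ‖z‖ 1 : ℝ) : ℂ) * (z / (‖z‖ : ℂ))

theorem measurable_truncate : Measurable truncate := by
  unfold truncate
  fun_prop

theorem norm_truncate (z : ℂ) : ‖truncate z‖ = min ‖z‖ 1 := by
  rcases eq_or_ne z 0 with rfl | hz
  · simp [truncate]
  · have : ‖z‖ ≠ 0 := norm_ne_zero_iff.2 hz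
    have h0 : 0 ≤ min ‖z‖ 1 := le_min (norm_nonneg z) zero_le_one
    rw [truncate, norm_mul, norm_div, Complex.norm_real, Complex.norm_real, norm_norm,
      div_self this, mul_one, Real.norm_of_nonneg h0]

theorem memLp_truncate (f : Lp ℂ 2 μ) : MemLp (fun x => truncate (f x)) 2 μ :=
  (Lp.memLp f).of_le
    (measurable_truncate.comp_aemeasurable (Lp.aestronglyMeasurable f).aemeasurable).aestronglyMeasurable
    (Eventually.of_forall fun x => (norm_truncate (f x)).le.trans (min_le_left _ _))

/-- The map `Q f = (|f| ∧ 1) sign f` on `L²(X)`. -/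
def Q (f : Lp ℂ 2 μ) : Lp ℂ 2 μ := (memLp_truncate μ f).toLp

/-- `Q f` is the point of `C_∞ = {g ∈ L²(X) : |g| ≤ 1 a.e.}` closest to `f`, that is, `Q` is the
orthogonal projection onto `C_∞`. -/
theorem Q_isProjection (f : Lp ℂ 2 μ) : (∀ᵐ x ∂μ, ‖Q μ f x‖ ≤ 1) ∧
    ∀ g : Lp ℂ 2 μ, (∀ᵐ x ∂μ, ‖g x‖ ≤ 1) → ‖f - Q μ f‖ ≤ ‖f - g‖ := by
  have hQ : ∀ᵐ x ∂μ, Q μ f x = truncate (f x) := (memLp_truncate μ f).coeFn_toLp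
  constructor
  · filter_upwards [hQ] with x hx
    rw [hx, norm_truncate]
    exact min_le_right _ _
  · intro g hg
    refine Lp.norm_le_norm_of_ae_le ?_
    filter_upwards [hQ, hg, Lp.coeFn_sub f (Q μ f), Lp.coeFn_sub f g] with x h1 h2 h3 h4
    rw [h3, h4, Pi.sub_apply, Pi.sub_apply, h1]
    generalize f x = z at *
    rcases le_or_gt ‖z‖ 1 with hz | hz
    · have : truncate z = z := by
        rcases eq_or_ne z 0 with rfl | h0
        · simp [truncate]
        · have : (‖z‖ : ℂ) ≠ 0 := by simpa using h0
          rw [truncate, min_eq_left hz]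
          field_simp
      simp [this]
    · have h0 : (‖z‖ : ℂ) ≠ 0 := by
        have : ‖z‖ ≠ 0 := by linarith
        exact_mod_cast this
      have e : z - truncate z = ((1 - 1 / ‖z‖ : ℝ) : ℂ) * z := by
        rw [truncate, min_eq_right hz.le]
        push_cast
        field_simp
      have hp : (0 : ℝ) ≤ 1 - 1 / ‖z‖ := by
        rw [sub_nonneg, div_le_one (by linarith)]
        exact hz.le
      have : ‖z - truncate z‖ = ‖z‖ - 1 := by
        rw [e, norm_mul, Complex.norm_real, Real.norm_of_nonneg hp]
        have : ‖z‖ ≠ 0 := by linarith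
        field_simp
      linarith [norm_sub_norm_le z (g x)]

/-- The embedding of `L^∞(X)` into `L²(X)` for a finite measure. -/
def linftyToL2 [IsFiniteMeasure μ] : Lp ℂ ∞ μ →ₗ[ℂ] Lp ℂ 2 μ where
  toFun f := ⟨f.1, Lp.antitone le_top f.2⟩
  map_add' _ _ := rfl
  map_smul' _ _ := rfl

theorem linftyToL2_injective [IsFiniteMeasure μ] : Function.Injective (linftyToL2 μ) :=
  fun f g h => Subtype.ext (show f.1 = g.1 from congrArg (fun k : Lp ℂ 2 μ => k.1) h)

end Lebesgue

end FormMethod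

end

/-! The core is that `l (l + A)⁻¹` maps C_∞ into itself for large `l`
(`SectorialForm.exists_rel_norm_le_one`). Let |f| ≤ 1, x = l (l + A)⁻¹ f, let u_n be a form-Cauchy
sequence defining x, let w_n be given by the hypothesis for u_n, and put v_n = u_n - w_n. The
hypothesis and the variational inequality of the projection `Q` give (l - ω) ‖j v_n‖² ≤ Re [a(u_n,
v_n) + l (j u_n | j v_n) - l (f | j v_n)]. For a fixed test vector the bracket would tend to 0 by
definition of A. Here the test vector moves and v_n need not converge, but (v_n) is bounded in the
form seminorm, and a form-Cauchy sequence converges weakly, uniformly on bounded sets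
(`tendsto_sub_zero_of_bounded`). Hence j u_n - Q (j u_n) → 0, so x is a limit of points of C_∞.

By scaling, l ‖u‖_∞ ≤ ‖(l + A) u‖_∞ for large `l`. Since l + A is onto L² by Lax-Milgram
(`SectorialForm.exists_rel`), the same bound puts the solution in L^∞ whenever the right-hand side
is there. A Neumann series then reaches every l > 0 (`isMDissipative_of_lt`). -/

namespace FormMethod

/-! ### Lax-Milgram for seminorms -/

section LaxMilgram

variable {V : Type*}

/-- The Lax-Milgram theorem in a space that need not be complete or separated: the solution
is a Cauchy sequence. -/
theorem exists_cauchySeq_tendsto_of_coercive [SeminormedAddCommGroup V] [InnerProductSpace ℂ V]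
    (b : V →ₗ[ℂ] V →ₗ⋆[ℂ] ℂ) {C : ℝ} (hC : ∀ u v, ‖b u v‖ ≤ C * ‖u‖ * ‖v‖)
    (hb : ∀ u, ‖u‖ ^ 2 ≤ (b u u).re) (φ : V →ₗ⋆[ℂ] ℂ) {M : ℝ} (hφ : ∀ v, ‖φ v‖ ≤ M * ‖v‖) :
    ∃ u : ℕ → V, CauchySeq u ∧ ∀ v, Tendsto (fun n => b (u n) v) atTop (𝓝 (φ v)) := by
  let W := UniformSpace.Completion V
  have riesz : ∀ (ψ : V →ₗ⋆[ℂ] ℂ) (N : ℝ), (∀ v, ‖ψ v‖ ≤ N * ‖v‖) →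
      ∃ w : W, ∀ v : V, inner ℂ (v : W) w = ψ v := by
    intro ψ N hN
    let ψ' : V →ₗ[ℂ] ℂ :=
      { toFun := fun v => starRingEnd ℂ (ψ v)
        map_add' := fun _ _ => by simp
        map_smul' := fun _ _ => by simp }
    let Ψ : V →L[ℂ] ℂ := ψ'.mkContinuous N (fun v => by simpa [ψ'] using hN v)
    let E : W →L[ℂ] ℂ := Ψ.extend (UniformSpace.Completion.toComplL (𝕜 := ℂ) (E := V))
    have hE : ∀ v : V, E (v : W) = starRingEnd ℂ (ψ v) := fun v =>
      Ψ.extend_eq (e := UniformSpace.Completion.toComplL (𝕜 := ℂ) (E := V))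
        (UniformSpace.Completion.denseRange_coe)
        (UniformSpace.Completion.isUniformInducing_coe V) v
    refine ⟨(InnerProductSpace.toDual ℂ W).symm E, fun v => ?_⟩
    rw [← inner_conj_symm, InnerProductSpace.toDual_symm_apply, hE]
    simp
  choose T hT using fun u : V => riesz (b u) (C * ‖u‖) (hC u)
  obtain ⟨F, hF⟩ := riesz φ M hφ
  have ext : ∀ w w' : W, (∀ v : V, (inner ℂ (v : W) w : ℂ) = inner ℂ (v : W) w') → w = w' := by
    intro w w' h
    refine UniformSpace.Completion.denseRange_coe.eq_of_inner_right ℂ ?_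
    exact h
  let S : V →ₗ[ℂ] W :=
    { toFun := T
      map_add' := fun u u' => ext _ _ fun v => by simp [inner_add_right, hT]
      map_smul' := fun c u => ext _ _ fun v => by simp [inner_smul_right, hT] }
  have hS : ∀ u v : V, (inner ℂ (v : W) (S u) : ℂ) = b u v := hT
  have hSle : ∀ u, ‖S u‖ ≤ C * ‖u‖ := by
    intro u
    have h : ∀ w : W, ‖(inner ℂ w (S u) : ℂ)‖ ≤ C * ‖u‖ * ‖w‖ := fun w =>
      UniformSpace.Completion.induction_on w
        (isClosed_le (by fun_prop) (by fun_prop)) fun v => by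
          rw [hS, UniformSpace.Completion.norm_coe]; exact hC u v
    have h1 := h (S u)
    rw [inner_self_eq_norm_sq_to_K, norm_pow, RCLike.norm_ofReal, abs_norm] at h1
    -- `C` has no assumed sign: if `‖S u‖ = 0`, then `0 ≤ C * ‖u‖` comes from the bound on `b u u`.
    rcases (norm_nonneg (S u)).eq_or_lt with h0 | h0
    · rw [← h0]
      rcases (norm_nonneg u).eq_or_lt with h2 | h2
      · simp [← h2]
      · exact nonneg_of_mul_nonneg_left ((norm_nonneg _).trans (hC u u)) h2
    · exact le_of_mul_le_mul_right (by linarith [sq ‖S u‖]) h0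
  have hSge : ∀ u, ‖u‖ ≤ ‖S u‖ := by
    intro u
    have h1 : ‖u‖ ^ 2 ≤ ‖u‖ * ‖S u‖ := by
      refine (hb u).trans ((Complex.re_le_norm _).trans ?_)
      rw [← hS, ← UniformSpace.Completion.norm_coe u]
      exact norm_inner_le_norm _ _
    rcases (norm_nonneg u).eq_or_lt with h | h
    · rw [← h]; exact norm_nonneg _
    · exact le_of_mul_le_mul_left (by linarith [sq ‖u‖]) h
  -- If w is orthogonal to the range and v_n → w with v_n in `V`, then ‖v_n‖² ≤ Re b(v_n, v_n),
  -- which is the real part of the product of S v_n with v_n - w and tends to 0; so w = 0.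
  have hdense : S.range.topologicalClosure = ⊤ := by
    rw [Submodule.topologicalClosure_eq_top_iff, Submodule.eq_bot_iff]
    intro w hw
    rw [Submodule.mem_orthogonal'] at hw
    obtain ⟨v, hv⟩ : ∃ v : ℕ → V, Tendsto (fun n => (v n : W)) atTop (𝓝 w) := by
      obtain ⟨x, hx, hlim⟩ := mem_closure_iff_seq_limit.1
        (UniformSpace.Completion.denseRange_coe (α := V) w)
      choose v hv using hx
      exact ⟨v, by simpa [hv] using hlim⟩
    have h1 : Tendsto (fun n => ‖(v n : W) - w‖ * (C * ‖(v n : W)‖)) atTop (𝓝 0) := by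
      have h2 : Tendsto (fun n => ‖(v n : W) - w‖) atTop (𝓝 0) :=
        tendsto_iff_norm_sub_tendsto_zero.1 hv
      simpa using h2.mul (hv.norm.const_mul C)
    have h3 : ∀ n, ‖(v n : W)‖ ^ 2 ≤ ‖(v n : W) - w‖ * (C * ‖(v n : W)‖) := by
      intro n
      rw [UniformSpace.Completion.norm_coe]
      refine (hb _).trans ((Complex.re_le_norm _).trans ?_)
      have e : b (v n) (v n) = inner ℂ ((v n : W) - w) (S (v n)) := by
        rw [inner_sub_left, hw _ ⟨v n, rfl⟩, sub_zero, hS]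
      rw [e]
      exact (norm_inner_le_norm _ _).trans
        (mul_le_mul_of_nonneg_left (hSle _) (norm_nonneg _))
    have h4 := le_of_tendsto_of_tendsto' (hv.norm.pow 2) h1 h3
    have h5 : ‖w‖ ^ 2 = 0 := le_antisymm h4 (sq_nonneg _)
    exact norm_eq_zero.1 (pow_eq_zero_iff two_ne_zero |>.1 h5)
  obtain ⟨x, hx, hlim⟩ := mem_closure_iff_seq_limit.1
    (show F ∈ closure (S.range : Set W) by
      rw [← Submodule.topologicalClosure_coe, hdense]; trivial)
  choose u hu using hx
  have hlim' : Tendsto (fun n => S (u n)) atTop (𝓝 F) := by simpa [hu] using hlim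
  refine ⟨u, ?_, fun v => ?_⟩
  · have := hlim'.cauchySeq
    rw [Metric.cauchySeq_iff] at this ⊢
    intro ε hε
    obtain ⟨N, hN⟩ := this ε hε
    refine ⟨N, fun m hm n hn => lt_of_le_of_lt ?_ (hN m hm n hn)⟩
    -- `S` is bounded below, so convergence of `S (u n)` forces `u` to be Cauchy.
    rw [dist_eq_norm, dist_eq_norm, ← map_sub]
    exact hSge _
  · simpa [hS, hF] using (tendsto_const_nhds (x := (v : W))).inner (𝕜 := ℂ) hlim'

/-- Lax-Milgram for a sesquilinear map with values in a sector, in terms of the seminorm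
`u ↦ (Re b(u,u))^{1/2}`. -/
theorem exists_seq_tendsto_of_sectorial [AddCommGroup V] [Module ℂ V]
    (b : V →ₗ[ℂ] V →ₗ⋆[ℂ] ℂ) {K : ℝ} (h : ∀ u, 0 ≤ (b u u).re ∧ ‖b u u‖ ≤ K * (b u u).re)
    (φ : V →ₗ⋆[ℂ] ℂ) {M : ℝ} (hφ : ∀ v, ‖φ v‖ ≤ M * √(b v v).re) :
    ∃ u : ℕ → V, Tendsto (fun p : ℕ × ℕ => (b (u p.1 - u p.2) (u p.1 - u p.2)).re) atTop (𝓝 0) ∧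
      ∀ v, Tendsto (fun n => b (u n) v) atTop (𝓝 (φ v)) := by
  -- The Hermitian part of `b`, written antilinear in the first slot; it may be degenerate.
  let core : PreInnerProductSpace.Core ℂ V :=
    { inner := fun u v => (starRingEnd ℂ (b u v) + b v u) / 2
      conj_inner_symm := fun u v => by simp [add_comm, Complex.conj_ofNat]
      re_inner_nonneg := fun u => by
        have := (h u).1
        simp; linarith
      add_left := fun u v w => by simp; ring
      smul_left := fun u v c => by simp; ring }
  let _ : SeminormedAddCommGroup V :=
    InnerProductSpace.Core.toSeminormedAddCommGroup (𝕜 := ℂ) (c := core)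
  let _ : InnerProductSpace ℂ V := InnerProductSpace.ofCore core
  have hsq : ∀ u : V, ‖u‖ ^ 2 = (b u u).re := by
    intro u
    rw [norm_sq_eq_re_inner (𝕜 := ℂ)]
    change ((starRingEnd ℂ (b u u) + b u u) / 2).re = _
    simp
  have hn : ∀ u : V, √(b u u).re = ‖u‖ := fun u => by
    rw [← hsq, Real.sqrt_sq (norm_nonneg u)]
  have hC : ∀ u v, ‖b u v‖ ≤ (2 * |K|) * ‖u‖ * ‖v‖ := by
    intro u v
    -- `weighted_bound` says that a quadratic polynomial in `s` is nonnegative; its discriminant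
    -- yields the constant `2 * |K|`.
    have hd := discrim_le_zero (a := |K| * ‖u‖ ^ 2) (b := -‖b u v‖) (c := |K| * ‖v‖ ^ 2) ?_
    · refine abs_le_of_sq_le_sq' ?_ (by positivity) |>.2
      unfold discrim at hd
      nlinarith
    · have hK : ∀ u, 0 ≤ (b u u).re ∧ ‖b u u‖ ≤ |K| * (b u u).re := fun u =>
        ⟨(h u).1, (h u).2.trans (mul_le_mul_of_nonneg_right (le_abs_self K) (h u).1)⟩
      intro s
      rcases le_total 0 s with hs | hs
      · have := weighted_bound b hK u v hs
        rw [← hsq, ← hsq] at this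
        nlinarith
      · have : 0 ≤ -s * ‖b u v‖ := mul_nonneg (by linarith) (norm_nonneg _)
        have h2 : 0 ≤ |K| * ‖u‖ ^ 2 * (s * s) := mul_nonneg (by positivity) (mul_self_nonneg s)
        have h3 : 0 ≤ |K| * ‖v‖ ^ 2 := by positivity
        linarith
  obtain ⟨u, hu, hv⟩ := exists_cauchySeq_tendsto_of_coercive b hC (fun u => (hsq u).le) φ
    (M := M) (fun v => by simpa only [hn] using hφ v)
  refine ⟨u, ?_, hv⟩
  have h1 := cauchySeq_iff_tendsto_dist_atTop_0.1 hu
  have h2 := h1.pow 2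
  simpa only [dist_eq_norm, hsq, ne_eq, OfNat.ofNat_ne_zero, not_false_eq_true, zero_pow] using h2

end LaxMilgram

/-! ### Variational inequality for the projection -/

section Projection

variable {X : Type*} [MeasurableSpace X] (μ : Measure X)

/-- The variational inequality for the projection `Q` onto `C_∞`. -/
theorem re_inner_sub_Q_nonneg (g f : Lp ℂ 2 μ) (hf : ∀ᵐ x ∂μ, ‖f x‖ ≤ 1) :
    0 ≤ (inner ℂ (g - Q μ g) (Q μ g - f) : ℂ).re := by
  obtain ⟨hQ1, hQ2⟩ := Q_isProjection μ g
  -- Minimality of `Q μ g` against the convex combination (1 - t) Qg + t f, expanded and divided by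
  -- t.
  have key : ∀ t : ℝ, 0 < t → t ≤ 1 →
      0 ≤ 2 * (inner ℂ (g - Q μ g) (Q μ g - f) : ℂ).re + t * ‖Q μ g - f‖ ^ 2 := by
    intro t ht ht1
    have h := hQ2 (Q μ g + ((t : ℝ) : ℂ) • (f - Q μ g)) (by
      filter_upwards [hQ1, hf, Lp.coeFn_add (Q μ g) (((t : ℝ) : ℂ) • (f - Q μ g)),
        Lp.coeFn_smul ((t : ℝ) : ℂ) (f - Q μ g), Lp.coeFn_sub f (Q μ g)] with x h1 h2 h3 h4 h5
      rw [h3, Pi.add_apply, h4, Pi.smul_apply, h5, Pi.sub_apply, smul_eq_mul]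
      have e : Q μ g x + (t : ℂ) * (f x - Q μ g x)
          = ((1 - t : ℝ) : ℂ) * Q μ g x + ((t : ℝ) : ℂ) * f x := by push_cast; ring
      rw [e]
      refine (norm_add_le _ _).trans ?_
      rw [norm_mul, norm_mul, Complex.norm_real, Complex.norm_real,
        Real.norm_of_nonneg ht.le, Real.norm_of_nonneg (by linarith)]
      nlinarith)
    have e : g - (Q μ g + ((t : ℝ) : ℂ) • (f - Q μ g))
        = (g - Q μ g) + ((t : ℝ) : ℂ) • (Q μ g - f) := by
      rw [smul_sub, smul_sub]; abel
    rw [e] at h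
    have h' := pow_le_pow_left₀ (norm_nonneg _) h 2
    rw [norm_add_sq (𝕜 := ℂ), inner_smul_right, norm_smul, Complex.norm_real,
      Real.norm_of_nonneg ht.le] at h'
    change _ ≤ _ + 2 * (((t : ℝ) : ℂ) * _).re + _ at h'
    rw [Complex.re_ofReal_mul] at h'
    have : 0 ≤ t * (2 * (inner ℂ (g - Q μ g) (Q μ g - f) : ℂ).re + t * ‖Q μ g - f‖ ^ 2) := by
      nlinarith
    exact nonneg_of_mul_nonneg_right this ht
  by_contra! hneg
  set r := (inner ℂ (g - Q μ g) (Q μ g - f) : ℂ).re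
  set s := ‖Q μ g - f‖ ^ 2 with hs
  have hs0 : 0 ≤ s := by positivity
  -- This `t` makes `t * s ≤ -r`, so `key` would give `0 ≤ r`.
  have := key (min 1 (-r / (s + 1))) (by
    refine lt_min one_pos (div_pos (by linarith) (by linarith))) (min_le_left _ _)
  have h2 : min 1 (-r / (s + 1)) * s ≤ -r := by
    refine (mul_le_mul_of_nonneg_right (min_le_right _ _) hs0).trans ?_
    rw [div_mul_eq_mul_div, div_le_iff₀ (by linarith)]
    nlinarith
  linarith

end Projection

/-! ### The shifted form: solvability and uniform weak convergence -/

section Shift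

variable {V H : Type*} [AddCommGroup V] [Module ℂ V]
  [NormedAddCommGroup H] [InnerProductSpace ℂ H]

/-- The shifted form `a(u,v) + l (j(u) | j(v))`. -/
noncomputable def SectorialForm.shift (𝔞 : SectorialForm V H) (l : ℝ) : V →ₗ[ℂ] V →ₗ⋆[ℂ] ℂ :=
  LinearMap.mk₂'ₛₗ (RingHom.id ℂ) (starRingEnd ℂ)
    (fun u v => 𝔞.a u v + (l : ℂ) * inner ℂ (𝔞.j v) (𝔞.j u))
    (fun _ _ _ => by simp only [map_add, LinearMap.add_apply, inner_add_right]; ring)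
    (fun _ _ _ => by
      simp only [map_smul, LinearMap.smul_apply, inner_smul_right, smul_eq_mul, RingHom.id_apply]
      ring)
    (fun _ _ _ => by simp only [map_add, inner_add_left]; ring)
    (fun _ _ _ => by
      simp only [map_smul, LinearMap.map_smulₛₗ, inner_smul_left, smul_eq_mul]
      ring)

theorem SectorialForm.shift_apply (𝔞 : SectorialForm V H) (l : ℝ) (u v : V) :
    𝔞.shift l u v = 𝔞.a u v + (l : ℂ) * inner ℂ (𝔞.j v) (𝔞.j u) := rfl

theorem SectorialForm.shift_self (𝔞 : SectorialForm V H) (l : ℝ) (u : V) :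
    𝔞.shift l u u = 𝔞.a u u + ((l * ‖𝔞.j u‖ ^ 2 : ℝ) : ℂ) := by
  rw [shift_apply, inner_self_eq_norm_sq_to_K]
  simp

theorem SectorialForm.shift_self_re (𝔞 : SectorialForm V H) (l : ℝ) (u : V) :
    (𝔞.shift l u u).re = (𝔞.a u u).re + l * ‖𝔞.j u‖ ^ 2 := by
  rw [shift_self, Complex.add_re, Complex.ofReal_re]

/-- For large `l` the shifted form is sectorial with vertex `0`, even with a positive margin. -/
theorem SectorialForm.exists_shift_bound (𝔞 : SectorialForm V H) :
    ∃ ω K : ℝ, 0 < K ∧ (∀ u, 0 ≤ (𝔞.a u u).re + ω * ‖𝔞.j u‖ ^ 2) ∧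
      ∀ l, ω < l → ∀ u, 0 ≤ (𝔞.shift l u u).re ∧
        ‖𝔞.shift l u u‖ ≤ K * (𝔞.shift l u u).re := by
  obtain ⟨ω, K, hK0, hK⟩ := 𝔞.exists_bound
  -- The extra 1 absorbs the term `(l - ω) * ‖𝔞.j u‖ ^ 2` and makes the constant positive.
  refine ⟨ω, K + 1, by linarith, fun u => (hK u).1, fun l hl u => ?_⟩
  obtain ⟨h1, h2⟩ := hK u
  have h3 : 0 ≤ (l - ω) * ‖𝔞.j u‖ ^ 2 := mul_nonneg (by linarith) (sq_nonneg _)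
  have e : 𝔞.shift l u u = (𝔞.a u u + ((ω * ‖𝔞.j u‖ ^ 2 : ℝ) : ℂ))
      + (((l - ω) * ‖𝔞.j u‖ ^ 2 : ℝ) : ℂ) := by
    rw [shift_self]; push_cast; ring
  have e2 := 𝔞.shift_self_re l u
  have h4 : ‖𝔞.shift l u u‖ ≤ K * ((𝔞.a u u).re + ω * ‖𝔞.j u‖ ^ 2) + (l - ω) * ‖𝔞.j u‖ ^ 2 := by
    rw [e]
    refine (norm_add_le _ _).trans (add_le_add h2 ?_)
    rw [Complex.norm_real, Real.norm_of_nonneg h3]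
  refine ⟨by linarith, ?_⟩
  rw [e2]
  nlinarith [mul_nonneg hK0 h3]

/-- `l + A` is surjective for large `l`. -/
theorem SectorialForm.exists_rel [CompleteSpace H] (𝔞 : SectorialForm V H) :
    ∃ ω : ℝ, ∀ l, ω < l → ∀ f : H, ∃ x : H, 𝔞.Rel x (f - (l : ℂ) • x) := by
  obtain ⟨ω, K, hK0, hω, hK⟩ := 𝔞.exists_shift_bound
  refine ⟨ω, fun l hl f => ?_⟩
  have hj : ∀ v, ‖𝔞.j v‖ ^ 2 ≤ (l - ω)⁻¹ * (𝔞.shift l v v).re := by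
    intro v
    rw [inv_mul_eq_div, le_div_iff₀ (by linarith), shift_self_re]
    linarith [hω v]
  have hlω : 0 ≤ (l - ω)⁻¹ := inv_nonneg.2 (by linarith)
  have hj' : ∀ v, ‖𝔞.j v‖ ≤ √(l - ω)⁻¹ * √(𝔞.shift l v v).re := by
    intro v
    rw [← Real.sqrt_mul hlω]
    exact Real.le_sqrt_of_sq_le (hj v)
  let φ : V →ₗ⋆[ℂ] ℂ :=
    { toFun := fun v => inner ℂ (𝔞.j v) f
      map_add' := fun _ _ => by rw [map_add, inner_add_left]
      map_smul' := fun _ _ => by rw [map_smul, inner_smul_left, smul_eq_mul] }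
  obtain ⟨u, hu, hv⟩ := exists_seq_tendsto_of_sectorial (𝔞.shift l) (hK l hl) φ
    (M := √(l - ω)⁻¹ * ‖f‖) (fun v => by
      refine (norm_inner_le_norm (𝕜 := ℂ) (𝔞.j v) f).trans ?_
      nlinarith [mul_le_mul_of_nonneg_right (hj' v) (norm_nonneg f)])
  -- The margin `l - ω > 0` lets the form seminorm control `j`, so `j (u n)` converges.
  have hsq : Tendsto (fun p : ℕ × ℕ => ‖𝔞.j (u p.1 - u p.2)‖ ^ 2) atTop (𝓝 0) :=
    squeeze_zero (fun _ => sq_nonneg _) (fun p => hj _) (by simpa using hu.const_mul (l - ω)⁻¹)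
  have hc : CauchySeq fun n => 𝔞.j (u n) := by
    rw [cauchySeq_iff_tendsto_dist_atTop_0]
    have := (Real.continuous_sqrt.tendsto 0).comp hsq
    simpa [Function.comp_def, Real.sqrt_sq, dist_eq_norm] using this
  obtain ⟨x, hx⟩ := cauchySeq_tendsto_of_complete hc
  refine ⟨x, u, hx, ?_, fun v => ?_⟩
  · have h1 : Tendsto (fun p : ℕ × ℕ => 𝔞.shift l (u p.1 - u p.2) (u p.1 - u p.2)) atTop (𝓝 0) :=
      squeeze_zero_norm (fun p => (hK l hl _).2) (by simpa using hu.const_mul K)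
    have h2 := h1.sub ((Complex.continuous_ofReal.tendsto 0).comp
      (by simpa using hsq.const_mul l : Tendsto (fun p : ℕ × ℕ =>
        l * ‖𝔞.j (u p.1 - u p.2)‖ ^ 2) atTop (𝓝 0)))
    simpa only [Function.comp_def, shift_self, add_sub_cancel_right, Complex.ofReal_zero, sub_zero]
      using h2
  · have h1 : Tendsto (fun n => (inner ℂ (𝔞.j v) (𝔞.j (u n)) : ℂ)) atTop
        (𝓝 (inner ℂ (𝔞.j v) x)) := (tendsto_const_nhds (x := 𝔞.j v)).inner hx
    have h2 := (hv v).sub (h1.const_mul (l : ℂ))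
    simpa [shift_apply, φ, inner_sub_right, inner_smul_right] using h2

/-- A Cauchy sequence for a sectorial sesquilinear map converges weakly, uniformly on
bounded sets. -/
theorem tendsto_sub_zero_of_bounded (b : V →ₗ[ℂ] V →ₗ⋆[ℂ] ℂ) {K : ℝ} (hK0 : 0 < K)
    (h : ∀ u, 0 ≤ (b u u).re ∧ ‖b u u‖ ≤ K * (b u u).re) {u v : ℕ → V} {φ : V → ℂ} {M : ℝ}
    (hu : Tendsto (fun p : ℕ × ℕ => (b (u p.1 - u p.2) (u p.1 - u p.2)).re) atTop (𝓝 0))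
    (hφ : ∀ v, Tendsto (fun n => b (u n) v) atTop (𝓝 (φ v)))
    (hv : ∀ᶠ n in atTop, (b (v n) (v n)).re ≤ M) :
    Tendsto (fun n => b (u n) (v n) - φ (v n)) atTop (𝓝 0) := by
  -- Apply `weighted_bound` to u_n - u_m and v_n with Re b(u_n - u_m, u_n - u_m) < 1/s², then let m
  -- → ∞. The right side does not depend on `s`.
  have key : ∀ s : ℝ, 0 < s → ∀ᶠ n in atTop, s * ‖b (u n) (v n) - φ (v n)‖ ≤ K * (1 + |M|) := by
    intro s hs
    obtain ⟨⟨N, N'⟩, hN⟩ := eventually_atTop.1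
      (hu.eventually (gt_mem_nhds (show (0 : ℝ) < 1 / s ^ 2 by positivity)))
    filter_upwards [hv, eventually_ge_atTop N] with n hn hnN
    refine le_of_tendsto' (((tendsto_const_nhds (x := b (u n) (v n))).sub
      (hφ (v n))).norm.const_mul s |>.comp (tendsto_add_atTop_nat N')) fun m => ?_
    have h1 := hN (n, m + N') ⟨hnN, Nat.le_add_left _ _⟩
    have h2 := weighted_bound b h (u n - u (m + N')) (v n) hs.le
    simp only [Function.comp_apply]
    have e : b (u n - u (m + N')) (v n) = b (u n) (v n) - b (u (m + N')) (v n) := by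
      rw [map_sub, LinearMap.sub_apply]
    rw [e] at h2
    refine h2.trans (mul_le_mul_of_nonneg_left (add_le_add ?_ (hn.trans (le_abs_self M))) hK0.le)
    rw [lt_div_iff₀ (by positivity)] at h1
    linarith
  rw [tendsto_zero_iff_norm_tendsto_zero, Metric.tendsto_nhds]
  intro ε hε
  -- `2 + |M|` rather than `1 + |M|` makes the final inequality strict.
  filter_upwards [key (K * (2 + |M|) / ε) (by positivity)] with n hn
  rw [Real.dist_eq, sub_zero, abs_norm]
  rw [div_mul_eq_mul_div, div_le_iff₀ hε] at hn
  have h1 : K * (1 + |M|) < K * (2 + |M|) := mul_lt_mul_of_pos_left (by linarith) hK0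
  have h2 : K * (2 + |M|) * ‖b (u n) (v n) - φ (v n)‖ < K * (2 + |M|) * ε :=
    hn.trans_lt (mul_lt_mul_of_pos_right h1 hε)
  exact lt_of_mul_lt_mul_left h2 (by positivity)

/-- Compare with one fixed late term: the parallelogram law bounds the quadratic form at x + y by
twice the sum of its values at x and y. -/
theorem eventually_re_le_of_cauchy (b : V →ₗ[ℂ] V →ₗ⋆[ℂ] ℂ) (h : ∀ u, 0 ≤ (b u u).re)
    {u : ℕ → V}
    (hu : Tendsto (fun p : ℕ × ℕ => (b (u p.1 - u p.2) (u p.1 - u p.2)).re) atTop (𝓝 0)) :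
    ∃ M : ℝ, ∀ᶠ n in atTop, (b (u n) (u n)).re ≤ M := by
  obtain ⟨⟨N, N'⟩, hN⟩ := eventually_atTop.1 (hu.eventually (gt_mem_nhds one_pos))
  refine ⟨2 + 2 * (b (u N') (u N')).re, ?_⟩
  filter_upwards [eventually_ge_atTop N] with n hn
  have h1 := hN (n, N') ⟨hn, le_rfl⟩
  have h2 := h (u n - u N' - u N')
  simp only [map_sub, LinearMap.sub_apply, Complex.sub_re] at h1 h2
  linarith

end Shift

/-! ### Invariance of the unit ball C_∞ -/

section Invariance

variable {X : Type*} [MeasurableSpace X] (μ : Measure X) {V : Type*} [AddCommGroup V] [Module ℂ V]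

/-- `C_∞` is invariant under `l (l + A)⁻¹` for large `l`. -/
theorem SectorialForm.exists_rel_norm_le_one (𝔞 : SectorialForm V (Lp ℂ 2 μ))
    (hQ : ∀ u : V, ∃ w : V, Q μ (𝔞.j u) = 𝔞.j w ∧ 0 ≤ (𝔞.a w (u - w)).re) :
    ∃ ω : ℝ, ∀ l, ω < l → 0 < l → ∀ x f : Lp ℂ 2 μ, (∀ᵐ t ∂μ, ‖f t‖ ≤ 1) →
      𝔞.Rel x ((l : ℂ) • (f - x)) → ∀ᵐ t ∂μ, ‖x t‖ ≤ 1 := by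
  obtain ⟨ω, K, hK0, hω, hK⟩ := 𝔞.exists_shift_bound
  refine ⟨ω, fun l hl hl0 x f hf hx => ?_⟩
  obtain ⟨u, h1, h2, h3⟩ := hx
  choose w hw1 hw2 using fun n => hQ (u n)
  set b := 𝔞.shift l with hb
  have hjv : ∀ n, 𝔞.j (u n - w n) = 𝔞.j (u n) - Q μ (𝔞.j (u n)) := fun n => by
    rw [map_sub, hw1]
  have hcauchy : Tendsto (fun p : ℕ × ℕ => (b (u p.1 - u p.2) (u p.1 - u p.2)).re)
      atTop (𝓝 0) := by
    have hj : Tendsto (fun p : ℕ × ℕ => l * ‖𝔞.j (u p.1 - u p.2)‖ ^ 2) atTop (𝓝 0) := by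
      have := (cauchySeq_iff_tendsto_dist_atTop_0.1 h1.cauchySeq).pow 2 |>.const_mul l
      simpa [dist_eq_norm] using this
    simpa only [hb, shift_self_re, Function.comp_def, Complex.zero_re, add_zero]
      using ((Complex.continuous_re.tendsto 0).comp h2).add hj
  have hlim : ∀ v, Tendsto (fun n => b (u n) v) atTop (𝓝 ((l : ℂ) * inner ℂ (𝔞.j v) f)) := by
    intro v
    have h4 : Tendsto (fun n => (inner ℂ (𝔞.j v) (𝔞.j (u n)) : ℂ)) atTop
        (𝓝 (inner ℂ (𝔞.j v) x)) := (tendsto_const_nhds (x := 𝔞.j v)).inner h1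
    have h5 := (h3 v).add (h4.const_mul (l : ℂ))
    rw [inner_smul_right, inner_sub_right, ← mul_add, sub_add_cancel] at h5
    exact h5
  obtain ⟨M, hM⟩ := eventually_re_le_of_cauchy b (fun u => (hK l hl u).1) hcauchy
  -- Since Re b(w_n, v_n) ≥ 0 for v_n = u_n - w_n, one has Re b(v_n, v_n) ≤ Re b(u_n, v_n). The
  -- weight `2 * K` in `weighted_bound` leaves half of Re b(v_n, v_n) to absorb on the left.
  have hbv : ∀ n, (b (u n - w n) (u n - w n)).re ≤ 4 * K ^ 2 * (b (u n) (u n)).re := by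
    intro n
    have e : b (u n) (u n - w n) = b (u n - w n) (u n - w n) + b (w n) (u n - w n) := by
      rw [← LinearMap.add_apply, ← map_add, sub_add_cancel]
    have hp : 0 ≤ (b (w n) (u n - w n)).re := by
      -- The point 0 of C_∞ makes the `l`-part of Re b(w_n, v_n) nonnegative.
      have h0 := re_inner_sub_Q_nonneg μ (𝔞.j (u n)) 0
        (by
            filter_upwards [Lp.coeFn_zero ℂ 2 μ] with t ht
            rw [ht]; simp)
      rw [sub_zero, hw1, ← map_sub] at h0
      rw [hb, shift_apply, Complex.add_re, Complex.re_ofReal_mul]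
      exact add_nonneg (hw2 n) (mul_nonneg hl0.le h0)
    have h5 := weighted_bound b (hK l hl) (u n) (u n - w n) (s := 2 * K) (by positivity)
    have h6 : 2 * (b (u n) (u n - w n)).re ≤
        (2 * K) ^ 2 * (b (u n) (u n)).re + (b (u n - w n) (u n - w n)).re := by
      refine le_of_mul_le_mul_left ?_ hK0
      have := mul_le_mul_of_nonneg_left (Complex.re_le_norm (b (u n) (u n - w n)))
        (show 0 ≤ 2 * K by positivity)
      linarith
    rw [e, Complex.add_re] at h6
    linarith
  have hMv : ∀ᶠ n in atTop, (b (u n - w n) (u n - w n)).re ≤ 4 * K ^ 2 * M := by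
    filter_upwards [hM] with n hn
    exact (hbv n).trans (mul_le_mul_of_nonneg_left hn (by positivity))
  have hdiff := tendsto_sub_zero_of_bounded b hK0 (hK l hl) hcauchy hlim hMv
  have hre := (Complex.continuous_re.tendsto 0).comp hdiff
  -- Split u_n = v_n + w_n in `a` and j u_n - f = j v_n + (Q (j u_n) - f) in the scalar product.
  -- Both cross terms have nonnegative real part, and Re a(v_n, v_n) ≥ -ω ‖j v_n‖².
  have hle : ∀ n, (l - ω) * ‖𝔞.j (u n) - Q μ (𝔞.j (u n))‖ ^ 2 ≤
      (b (u n) (u n - w n) - (l : ℂ) * inner ℂ (𝔞.j (u n - w n)) f).re := by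
    intro n
    have h5 := re_inner_sub_Q_nonneg μ (𝔞.j (u n)) f hf
    have h6 := hω (u n - w n)
    rw [← hjv] at h5
    have e1 : 𝔞.a (u n) (u n - w n) = 𝔞.a (u n - w n) (u n - w n) + 𝔞.a (w n) (u n - w n) := by
      rw [← LinearMap.add_apply, ← map_add, sub_add_cancel]
    have e2 : (inner ℂ (𝔞.j (u n - w n)) (𝔞.j (u n)) : ℂ) - inner ℂ (𝔞.j (u n - w n)) f
        = ((‖𝔞.j (u n - w n)‖ ^ 2 : ℝ) : ℂ)
          + inner ℂ (𝔞.j (u n) - Q μ (𝔞.j (u n))) (Q μ (𝔞.j (u n)) - f) := by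
      rw [← inner_sub_right, hjv]
      have : 𝔞.j (u n) - f = (𝔞.j (u n) - Q μ (𝔞.j (u n))) + (Q μ (𝔞.j (u n)) - f) := by abel
      rw [this, inner_add_right, inner_self_eq_norm_sq_to_K]
      simp
    rw [hb, shift_apply, add_sub_assoc, ← mul_sub, e2, e1, Complex.add_re, Complex.add_re,
      Complex.re_ofReal_mul, Complex.add_re, Complex.ofReal_re, ← hjv]
    nlinarith [hw2 n, mul_nonneg hl0.le h5]
  have hsq : Tendsto (fun n => ‖𝔞.j (u n) - Q μ (𝔞.j (u n))‖ ^ 2) atTop (𝓝 0) := by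
    have h5 : Tendsto (fun n => (l - ω) * ‖𝔞.j (u n) - Q μ (𝔞.j (u n))‖ ^ 2) atTop (𝓝 0) :=
      squeeze_zero (fun n => mul_nonneg (by linarith) (sq_nonneg _)) hle
        (by simpa [Function.comp_def] using hre)
    have h6 := h5.const_mul (l - ω)⁻¹
    have : l - ω ≠ 0 := by linarith
    simpa [this] using h6
  have hn : Tendsto (fun n => ‖𝔞.j (u n) - Q μ (𝔞.j (u n))‖) atTop (𝓝 0) := by
    have := (Real.continuous_sqrt.tendsto 0).comp hsq
    simpa [Function.comp_def, Real.sqrt_sq] using this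
  have hQlim : Tendsto (fun n => ‖x - Q μ (𝔞.j (u n))‖) atTop (𝓝 0) := by
    have := (tendsto_const_nhds (x := x)).sub (h1.sub (tendsto_zero_iff_norm_tendsto_zero.2 hn))
    simpa using this.norm
  -- `Q μ x` is at least as close to `x` as each `Q μ (𝔞.j (u n))`, so continuity of `Q` is not
  -- needed.
  have hxQ : ‖x - Q μ x‖ ≤ 0 := ge_of_tendsto' hQlim fun n =>
    (Q_isProjection μ x).2 _ (Q_isProjection μ _).1
  rw [norm_le_zero_iff, sub_eq_zero] at hxQ
  rw [hxQ]
  exact (Q_isProjection μ x).1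

end Invariance

/-! ### From large parameters to m-dissipativity -/

section Resolvent

variable {Z : Type*} [NormedAddCommGroup Z] [NormedSpace ℂ Z]

/-- Dissipativity at `l` gives both injectivity of l - B and the bound on its inverse. -/
theorem exists_isResolvent (B : Z →ₗ.[ℂ] Z) {l : ℝ} (hl : 0 < l)
    (hsurj : ∀ f : Z, ∃ u : B.domain, (l : ℂ) • (u : Z) - B u = f)
    (hdiss : ∀ u : B.domain, l * ‖(u : Z)‖ ≤ ‖(l : ℂ) • (u : Z) - B u‖) :
    ∃ R : Z →L[ℂ] Z, IsResolvent B (l : ℂ) R ∧ ‖(l : ℂ) • R‖ ≤ 1 := by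
  let T : B.domain →ₗ[ℂ] Z := (l : ℂ) • B.domain.subtype - B.toFun
  have hT : ∀ u : B.domain, T u = (l : ℂ) • (u : Z) - B u := fun _ => rfl
  have hinj : Function.Injective T := by
    rw [← LinearMap.ker_eq_bot, Submodule.eq_bot_iff]
    intro u hu
    have h := hdiss u
    rw [← hT, LinearMap.mem_ker.1 hu, norm_zero] at h
    exact Subtype.ext (norm_le_zero_iff.1 (nonpos_of_mul_nonpos_right h hl))
  let E := LinearEquiv.ofBijective T ⟨hinj, hsurj⟩
  have hE : ∀ f, (l : ℂ) • (E.symm f : Z) - B (E.symm f) = f := fun f =>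
    E.apply_symm_apply f
  have hbound : ∀ f, l * ‖(E.symm f : Z)‖ ≤ ‖f‖ := fun f => by
    simpa only [hE] using hdiss (E.symm f)
  let R : Z →L[ℂ] Z := (B.domain.subtype ∘ₗ (E.symm : Z →ₗ[ℂ] B.domain)).mkContinuous l⁻¹
    (fun f => by
      rw [inv_mul_eq_div, le_div_iff₀ hl, mul_comm]
      exact hbound f)
  have hR : ∀ f, R f = E.symm f := fun _ => rfl
  refine ⟨R, ⟨fun f => ⟨(E.symm f).2, hE f⟩, fun u => ?_⟩, ?_⟩
  · rw [hR]
    exact congrArg Subtype.val (E.symm_apply_apply u)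
  · refine ContinuousLinearMap.opNorm_le_bound _ zero_le_one fun f => ?_
    rw [smul_apply, norm_smul, Complex.norm_real, Real.norm_of_nonneg hl.le,
      one_mul, hR]
    exact hbound f

/-- A dissipative operator is m-dissipative as soon as all large `l` are in the resolvent set. -/
theorem isMDissipative_of_lt [CompleteSpace Z] (B : Z →ₗ.[ℂ] Z) (ω : ℝ)
    (hsurj : ∀ l : ℝ, ω < l → ∀ f : Z, ∃ u : B.domain, (l : ℂ) • (u : Z) - B u = f)
    (hdiss : ∀ l : ℝ, ω < l → 0 < l → ∀ u : B.domain, l * ‖(u : Z)‖ ≤ ‖(l : ℂ) • (u : Z) - B u‖) :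
    IsMDissipative B := by
  intro l hl
  obtain ⟨L, hLl, hLω⟩ : ∃ L : ℝ, l < L ∧ ω < L := by
    obtain ⟨L, hL⟩ := exists_gt (max l ω)
    exact ⟨L, (le_max_left _ _).trans_lt hL, (le_max_right _ _).trans_lt hL⟩
  have hL0 : 0 < L := hl.trans hLl
  have split : ∀ u : B.domain, (L : ℂ) • (u : Z) - B u
      = ((l : ℂ) • (u : Z) - B u) + ((L - l : ℝ) : ℂ) • (u : Z) := by
    intro u
    rw [Complex.ofReal_sub, sub_smul]
    abel
  obtain ⟨R, ⟨hR1, -⟩, hR3⟩ := exists_isResolvent B hL0 (hsurj L hLω) (hdiss L hLω hL0)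
  refine exists_isResolvent B hl (fun f => ?_) (fun u => ?_)
  -- Neumann series: l - B = (1 - (L - l) R)(L - B) and ‖(L - l) R‖ ≤ (L - l)/L < 1, so a single
  -- step from `L` reaches any `l` in (0, L).
  · have hnorm : ‖((L - l : ℝ) : ℂ) • R‖ < 1 := by
      rw [norm_smul, Complex.norm_real, Real.norm_of_nonneg (by linarith)]
      rw [norm_smul, Complex.norm_real, Real.norm_of_nonneg hL0.le] at hR3
      rcases (norm_nonneg R).eq_or_lt with h | h
      · rw [← h, mul_zero]; exact one_pos
      · exact (mul_lt_mul_of_pos_right (by linarith) h).trans_le hR3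
    obtain ⟨S, hS⟩ := isUnit_one_sub_of_norm_lt_one hnorm
    obtain ⟨h, hh⟩ := hR1 ((↑S⁻¹ : Z →L[ℂ] Z) f)
    refine ⟨⟨_, h⟩, ?_⟩
    have e := split ⟨_, h⟩
    rw [hh] at e
    have e2 : (1 - ((L - l : ℝ) : ℂ) • R) ((↑S⁻¹ : Z →L[ℂ] Z) f) = f := by
      rw [← hS, ← mul_apply_eq_comp, S.mul_inv, one_apply_eq_self]
    rw [sub_apply, one_apply_eq_self,
      smul_apply] at e2
    exact (eq_sub_iff_add_eq.2 e.symm).trans e2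
  -- Dissipativity passes down from `L` to `l`: L ‖u‖ ≤ ‖(l - B) u‖ + (L - l) ‖u‖.
  · have h1 := hdiss L hLω hL0 u
    rw [split] at h1
    have h2 := h1.trans (norm_add_le _ _)
    rw [norm_smul, Complex.norm_real, Real.norm_of_nonneg (by linarith)] at h2
    linarith

end Resolvent

/-! ### Essential bounds and the L^∞ norm -/

section Linfty

variable {X : Type*} [MeasurableSpace X] (μ : Measure X)

theorem ae_norm_le_norm_linfty (f : Lp ℂ ∞ μ) : ∀ᵐ t ∂μ, ‖f t‖ ≤ ‖f‖ := by
  filter_upwards [ae_le_eLpNormEssSup (f := f) (μ := μ)] with t ht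
  rw [Lp.norm_def, eLpNorm_exponent_top]
  have hfin : eLpNormEssSup f μ ≠ ∞ := by
    rw [← eLpNorm_exponent_top]; exact Lp.eLpNorm_ne_top f
  simpa using ENNReal.toReal_mono hfin ht

theorem norm_linfty_le {f : Lp ℂ ∞ μ} {M : ℝ} (hM : 0 ≤ M) (h : ∀ᵐ t ∂μ, ‖f t‖ ≤ M) :
    ‖f‖ ≤ M := by
  rw [Lp.norm_def, eLpNorm_exponent_top]
  exact ENNReal.toReal_le_of_le_ofReal hM (eLpNormEssSup_le_of_ae_bound h)

end Linfty

end FormMethod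

/-! ### The part of A in L^∞ -/

open FormMethod in
theorem corollary2p3 {X : Type*} [MeasurableSpace X] (μ : MeasureTheory.Measure X)
    [MeasureTheory.IsFiniteMeasure μ] {V : Type*} [AddCommGroup V] [Module ℂ V]
    (𝔞 : FormMethod.SectorialForm V (MeasureTheory.Lp ℂ 2 μ))
    (hQ : ∀ u : V, ∃ w : V,
      FormMethod.Q μ (𝔞.j u) = 𝔞.j w ∧ 0 ≤ (𝔞.a w (u - w)).re) :
    FormMethod.IsMDissipative
      (-(FormMethod.part 𝔞.operator (FormMethod.linftyToL2 μ))) := by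
  set ι := linftyToL2 μ
  have hιinj : Function.Injective ι := linftyToL2_injective μ
  set P := part 𝔞.operator ι
  have hgraph : ∀ u v, (u, v) ∈ P.graph ↔ 𝔞.Rel (ι u) (ι v) := fun u v => by
    rw [← 𝔞.mem_graph_operator, mem_graph_part _ _ hιinj]
    simp
  obtain ⟨ω₁, hω₁⟩ := 𝔞.exists_rel
  obtain ⟨ω₂, hω₂⟩ := 𝔞.exists_rel_norm_le_one μ hQ
  -- Invariance of C_∞ applied to `f / M`, whose image under `l (l + A)⁻¹` is `(l / M) • x`. A free
  -- `M > 0` instead of `‖f‖` avoids dividing by zero.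
  have hbound : ∀ l : ℝ, ω₂ < l → 0 < l → ∀ (x y : Lp ℂ 2 μ) (f : Lp ℂ ∞ μ), 𝔞.Rel x y →
      (l : ℂ) • x + y = ι f → ∀ M : ℝ, 0 < M → ‖f‖ ≤ M → ∀ᵐ t ∂μ, ‖x t‖ ≤ M / l := by
    intro l hl hl0 x y f hxy hf M hM hfM
    have hM' : (M : ℂ) ≠ 0 := by exact_mod_cast hM.ne'
    have hr := hxy.smul ((l : ℂ) / M)
    have hC := hω₂ l hl hl0 (((l : ℂ) / M) • x) (((1 : ℂ) / M) • ι f) ?_ ?_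
    · filter_upwards [hC, Lp.coeFn_smul ((l : ℂ) / M) x] with t h1 h2
      rw [h2, Pi.smul_apply, norm_smul, norm_div, Complex.norm_real, Complex.norm_real,
        Real.norm_of_nonneg hl0.le, Real.norm_of_nonneg hM.le, div_mul_eq_mul_div,
        div_le_one hM] at h1
      rw [le_div_iff₀ hl0]
      linarith
    · filter_upwards [ae_norm_le_norm_linfty μ f, Lp.coeFn_smul ((1 : ℂ) / M) (ι f)] with t h1 h2
      rw [h2, Pi.smul_apply, norm_smul, norm_div, Complex.norm_real, norm_one,
        Real.norm_of_nonneg hM.le, div_mul_eq_mul_div, one_mul, div_le_one hM]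
      exact h1.trans hfM
    · convert hr using 1
      rw [← hf, smul_sub, smul_smul, smul_smul, smul_add, smul_smul]
      have e : (l : ℂ) * (1 / M) = l / M := by ring
      rw [e, mul_comm (l : ℂ) (l / M)]
      abel
  refine isMDissipative_of_lt _ (max ω₁ (max ω₂ 0)) (fun l hl f => ?_) (fun l hl hl0 u => ?_)
  · have h1 : ω₁ < l := (le_max_left _ _).trans_lt hl
    have h2 : ω₂ < l := ((le_max_left _ _).trans (le_max_right _ _)).trans_lt hl
    have h0 : 0 < l := ((le_max_right _ _).trans (le_max_right _ _)).trans_lt hl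
    obtain ⟨x, hx⟩ := hω₁ l h1 (ι f)
    -- Only boundedness of `x` matters here, so `‖f‖ + 1` serves as a positive `M`.
    have hb := hbound l h2 h0 x _ f hx (add_sub_cancel _ _) (‖f‖ + 1) (by positivity) (by linarith)
    have hmem : MemLp x ∞ μ := memLp_top_of_bound (Lp.aestronglyMeasurable x) _ hb
    let u : Lp ℂ ∞ μ := ⟨x.1, Lp.mem_Lp_iff_memLp.2 hmem⟩
    have hu : ι u = x := rfl
    have hg : (u, f - (l : ℂ) • u) ∈ P.graph := by
      rw [hgraph, map_sub, map_smul, hu]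
      exact hx
    obtain ⟨d, hd1, hd2⟩ := P.mem_graph_iff.1 hg
    refine ⟨d, ?_⟩
    rw [LinearPMap.neg_apply, hd2, hd1]
    simp
  · have h2 : ω₂ < l := ((le_max_left _ _).trans (le_max_right _ _)).trans_lt hl
    have hrel : 𝔞.Rel (ι u) (ι (P u)) := (hgraph _ _).1 (P.mem_graph u)
    rw [LinearPMap.neg_apply, sub_neg_eq_add]
    -- The sharp constant is recovered by letting `M` decrease to the norm.
    refine le_of_forall_gt_imp_ge_of_dense fun M hM => ?_
    have hM0 : 0 < M := (norm_nonneg _).trans_lt hM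
    have hb := hbound l h2 hl0 _ _ ((l : ℂ) • (u : Lp ℂ ∞ μ) + P u) hrel
      (by rw [map_add, map_smul]) M hM0 hM.le
    have := norm_linfty_le μ (f := (u : Lp ℂ ∞ μ)) (by positivity) hb
    rw [le_div_iff₀ hl0] at this
    linarith
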